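/- Let $\Omega_n=\{0,1\}^n$ carry the uniform probability measure $\mathbf P$, with expectation $\mathbf E$. For $x\in\Omega_n$ and $\epsilon\in(0,1)$ let $N_\epsilon(x)$ be the random element of $\Omega_n$ obtained from $x$ by flipping each coordinate with probability $\epsilon$, independently for distinct coordinates. For an event $\mathcal A\subset\Omega_n$ put $$\phi(\mathcal A,\epsilon)=\inf\Bigl\{\delta>0:\ \mathbf P\bigl\{x:\ \bigl|\mathbf P(N_\epsilon(x)\in\mathcal A\mid x)-\mathbf P(\mathcal A)\bigr|>\delta\bigr\}<\delta\Bigr\}.$$ A sequence of events $\mathcal A_m\subset\Omega_{n_m}$ is called asymptotically noise sensitive if $\lim_{m\to\infty}\phi(\mathcal A_m,\epsilon)=0$ for every $\epsilon\in(0,1/2)$. An event is monotone if its indicator function $\chi_{\mathcal A}$ is nondecreasing for the coordinatewise order. For $\mathbf w=(w_1,\dots,w_n)\in[0,1]^n$ let $M_{\mathbf w}(x)=\operatorname{sign}\bigl(\sum_{j=1}^n(2x_j-1)w_j\bigr)$, where $\operatorname{sign}(0)=0$, and let $$\widetilde\Lambda(\mathcal A)=\max\bigl\{|\mathbf E(\chi_{\mathcal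 A}M_{\mathbf w})|:\ \mathbf w\in[0,1]^n\bigr\}.$$ **Theorem.** Let $\mathcal A_m\subset\Omega_{n_m}$, $m=1,2,\dots$, be a sequence of monotone events. Then $\{\mathcal A_m\}$ is asymptotically noise sensitive if and only if $\lim_{m\to\infty}\widetilde\Lambda(\mathcal A_m)=0$. -/

import Mathlib

open Filter Topology

namespace NoiseSensitivity

noncomputable section

/-- The Hamming cube `{0,1}^n`, with `false` as `0` and `true` as `1`;
its order is the coordinatewise one, with `false < true`. -/
abbrev Cube (n : ℕ) : Type := Fin n → Bool

/-- The indicator function of an event. -/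
def chi {n : ℕ} (A : Set (Cube n)) : Cube n → ℝ := A.indicator 1

/-- Expectation under the uniform probability measure on the cube. -/
def expect {n : ℕ} (f : Cube n → ℝ) : ℝ := (∑ x, f x) / 2 ^ n

/-- Probability of an event under the uniform probability measure. -/
def prob {n : ℕ} (A : Set (Cube n)) : ℝ := expect (chi A)

/-- The probability that the noisy version `N_ε(x)` of `x` equals `y`: independently for distinct
`j`, the bit `j` of `N_ε(x)` is `x j` with probability `1 - ε`, and is flipped with
probability `ε`. -/
def noiseWeight {n : ℕ} (ε : ℝ) (x y : Cube n) : ℝ :=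
  ∏ j, if y j = x j then 1 - ε else ε

/-- The conditional probability `P(N_ε(x) ∈ A | x)`. -/
def noiseProb {n : ℕ} (A : Set (Cube n)) (ε : ℝ) (x : Cube n) : ℝ :=
  ∑ y, noiseWeight ε x y * chi A y

/-- `γ(A, ε, δ) = P {x : |P(N_ε(x) ∈ A | x) - P(A)| > δ}`. -/
def gamma {n : ℕ} (A : Set (Cube n)) (ε δ : ℝ) : ℝ :=
  prob {x : Cube n | |noiseProb A ε x - prob A| > δ}

/-- The sensitivity gauge `φ(A, ε) = inf {δ > 0 : γ(A, ε, δ) < δ}`. -/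
def gauge {n : ℕ} (A : Set (Cube n)) (ε : ℝ) : ℝ :=
  sInf {δ : ℝ | 0 < δ ∧ gamma A ε δ < δ}

/-- Asymptotic noise sensitivity of a sequence of events `A m` in the cubes `{0,1}^(n m)`. -/
def AsymptoticallyNoiseSensitive {n : ℕ → ℕ} (A : ∀ m, Set (Cube (n m))) : Prop :=
  ∀ ε : ℝ, 0 < ε → ε < 1 / 2 → Tendsto (fun m => gauge (A m) ε) atTop (𝓝 0)

/-- An event is monotone if its indicator function is. -/
def MonotoneEvent {n : ℕ} (A : Set (Cube n)) : Prop := Monotone (chi A)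

/-- The weighted majority function `M_w(x) = sign (∑ j, (2 x_j - 1) w_j)`, with `sign 0 = 0`. -/
def weightedMajority {n : ℕ} (w : Fin n → ℝ) (x : Cube n) : ℝ :=
  Real.sign (∑ j, (2 * ((x j).toNat : ℝ) - 1) * w j)

/-- The set of all absolute correlations `|E(χ_A M_w)|`, for `w ∈ [0,1]^n`. -/
def majorityCorrelations {n : ℕ} (A : Set (Cube n)) : Set ℝ :=
  {r | ∃ w : Fin n → ℝ, (∀ j, 0 ≤ w j ∧ w j ≤ 1) ∧
    r = |expect fun x => chi A x * weightedMajority w x|}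

/-- The maximal correlation with weighted majority functions; the supremum is a maximum, by
`isGreatest_maxMajorityCorrelation`. -/
def maxMajorityCorrelation {n : ℕ} (A : Set (Cube n)) : ℝ := sSup (majorityCorrelations A)

theorem isGreatest_maxMajorityCorrelation {n : ℕ} (A : Set (Cube n)) :
    IsGreatest (majorityCorrelations A) (maxMajorityCorrelation A) := by
  have hne : (majorityCorrelations A).Nonempty :=
    ⟨_, 0, fun _ => ⟨le_refl _, zero_le_one⟩, rfl⟩
  have hfin : (majorityCorrelations A).Finite := by
    refine (Set.finite_range fun g : Cube n → SignType =>
      |expect fun x => chi A x * ((g x : SignType) : ℝ)|).subset ?_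
    rintro r ⟨w, -, rfl⟩
    refine ⟨fun x => SignType.sign (∑ j, (2 * ((x j).toNat : ℝ) - 1) * w j), ?_⟩
    have h : ∀ t : ℝ, ((SignType.sign t : SignType) : ℝ) = Real.sign t := by
      intro t
      rcases lt_trichotomy t 0 with ht | ht | ht
      · simp [sign_neg ht, Real.sign_of_neg ht]
      · simp [ht]
      · simp [sign_pos ht, Real.sign_of_pos ht]
    simp only [h, weightedMajority]
  exact ⟨hne.csSup_mem hfin, fun r hr => le_csSup hfin.bddAbove hr⟩

end

end NoiseSensitivity

/-!
Write `f` for the indicator function of a monotone event and `W = levelOne f` for the sum of the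
squares of its first level Fourier–Walsh coefficients.

If the events are noise sensitive, then they are asymptotically uncorrelated with every family of
functions that is uniformly stable under noise. Weighted majorities are such a family
(`expect_sum_noiseWeight_abs_sub_le`): noise of rate `1 / m` is the flip of one of `m` random
blocks of coordinates, and the total influence of `m` blocks on a weighted majority is at most
`2 √m`, because flipping a block moves the majority against the sign of that block and the block
signs are uncorrelated.

Conversely, there are two steps. Small correlations with all weighted majorities force `W` to be
small (`sqrt_levelOne_cube_le`). The weights tested are random: the numbers of visits to each
coordinate among `2 m + 1` independent draws with probabilities `p j` proportional to
`coeff f {j}`, which are nonnegative by monotonicity. Averaged over the draws, the majority at `x`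
becomes the expected sign of a `±1` walk with mean `L x = ∑ j, p j * rad (x j)`, which is the
explicit polynomial `L ∑ i ≤ m, centralBinom i / 4 ^ i * (1 - L ^ 2) ^ i`
(`walk_iterate_sign`). For `m` about `√W / ∑ j, p j ^ 2` its linear part dominates, and the
correlation of `f` with `L` is governed by `W`.

A small `W` in turn makes a monotone `f` noise sensitive (`expect_noiseOp_sub_sq_le`). For a set
`I` of coordinates, the conditional covariances `h j` of `f` with the bits `j ∈ I`, given the
coordinates outside `I`, are nonnegative with means `coeff f {j}`, and the sum of their second
moments is at most `1`, since a set `U` contributes to it only if `U ∩ I` is a single point.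
Hypercontractivity gives `‖T h j‖₂² ≤ ‖h j‖₁ ‖h j‖₂`, and Cauchy–Schwarz over `j` bounds the
(damped) Fourier mass on the sets meeting `I` in one point by `√W`, without the factor
`log (1 / ‖h j‖₁)` that a coordinatewise estimate would give. Averaging over `I` reaches every
nonempty set.
-/

namespace NoiseSensitivity

open Finset

/-! ### Fourier–Walsh analysis and noise operators on the cube -/

/-- The Rademacher encoding of a bit: `true` is `1` and `false` is `-1`. -/
noncomputable def rad (b : Bool) : ℝ := if b then 1 else -1

@[simp] theorem rad_true : rad true = 1 := rfl

@[simp] theorem rad_false : rad false = -1 := by simp [rad]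

@[simp] theorem rad_not (b : Bool) : rad (!b) = -rad b := by cases b <;> simp

@[simp] theorem rad_mul_self (b : Bool) : rad b * rad b = 1 := by cases b <;> simp

theorem two_mul_toNat_sub_one (b : Bool) : 2 * (b.toNat : ℝ) - 1 = rad b := by
  cases b <;> norm_num

variable {n : ℕ}

theorem expect_add (f g : Cube n → ℝ) :
    expect (fun x => f x + g x) = expect f + expect g := by
  simp [expect, sum_add_distrib, add_div]

theorem expect_sub (f g : Cube n → ℝ) :
    expect (fun x => f x - g x) = expect f - expect g := by
  simp [expect, sum_sub_distrib, sub_div]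

theorem expect_const_mul (c : ℝ) (f : Cube n → ℝ) :
    expect (fun x => c * f x) = c * expect f := by
  simp [expect, ← mul_sum, mul_div_assoc]

theorem expect_mul_const (c : ℝ) (f : Cube n → ℝ) :
    expect (fun x => f x * c) = expect f * c := by
  simp [expect, ← sum_mul, mul_div_right_comm]

theorem expect_const (c : ℝ) : expect (fun _ : Cube n => c) = c := by
  simp [expect]

theorem expect_sum {ι : Type*} (s : Finset ι) (f : ι → Cube n → ℝ) :
    expect (fun x => ∑ i ∈ s, f i x) = ∑ i ∈ s, expect (f i) := by
  simp only [expect]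
  rw [sum_comm, sum_div]

theorem expect_mono {f g : Cube n → ℝ} (h : ∀ x, f x ≤ g x) : expect f ≤ expect g := by
  unfold expect
  gcongr
  exact h _

theorem expect_nonneg {f : Cube n → ℝ} (h : ∀ x, 0 ≤ f x) : 0 ≤ expect f :=
  div_nonneg (sum_nonneg fun x _ => h x) (by positivity)

theorem abs_expect_le (f : Cube n → ℝ) : |expect f| ≤ expect fun x => |f x| := by
  unfold expect
  rw [abs_div, abs_of_pos (by positivity : (0 : ℝ) < 2 ^ n)]
  gcongr
  exact abs_sum_le_sum_abs _ _

theorem expect_comp_equiv (e : Cube n ≃ Cube n) (f : Cube n → ℝ) :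
    (expect fun x => f (e x)) = expect f := by
  simp only [expect]
  rw [e.sum_comp]

theorem expect_mul_sq_le (f g : Cube n → ℝ) :
    (expect fun x => f x * g x) ^ 2 ≤ (expect fun x => f x ^ 2) * expect fun x => g x ^ 2 := by
  have h := sum_mul_sq_le_sq_mul_sq univ f g
  simp only [expect]
  rw [div_pow, div_mul_div_comm, sq ((2 : ℝ) ^ n)]
  gcongr

/-- Negation of all coordinates in a set `s`. -/
def flip (s : Finset (Fin n)) (x : Cube n) : Cube n := fun i => if i ∈ s then !x i else x i

theorem flip_flip (s : Finset (Fin n)) (x : Cube n) : flip s (flip s x) = x := by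
  funext i
  by_cases h : i ∈ s <;> simp [flip, h]

/-- `flip` as a permutation of the cube. -/
def flipEquiv (s : Finset (Fin n)) : Cube n ≃ Cube n :=
  ⟨flip s, flip s, flip_flip s, flip_flip s⟩

theorem expect_flip (s : Finset (Fin n)) (f : Cube n → ℝ) :
    (expect fun x => f (flip s x)) = expect f :=
  expect_comp_equiv (flipEquiv s) f

/-- A function that is odd under some flip has mean zero. -/
theorem expect_eq_zero_of_flip (s : Finset (Fin n)) {f : Cube n → ℝ}
    (h : ∀ x, f (flip s x) = -f x) : expect f = 0 := by
  have h1 := expect_flip s f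
  simp only [h] at h1
  have h2 : expect (fun x => -f x) = -expect f := by simp [expect, neg_div]
  linarith

/-- The Walsh function indexed by `S`. -/
noncomputable def walsh (S : Finset (Fin n)) (x : Cube n) : ℝ := ∏ i ∈ S, rad (x i)

/-- The Fourier–Walsh coefficient of `f` at `S`. -/
noncomputable def coeff (f : Cube n → ℝ) (S : Finset (Fin n)) : ℝ :=
  expect fun x => f x * walsh S x

@[simp] theorem walsh_empty (x : Cube n) : walsh ∅ x = 1 := by simp [walsh]

@[simp] theorem walsh_singleton (j : Fin n) (x : Cube n) : walsh {j} x = rad (x j) := by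
  simp [walsh]

theorem coeff_empty (f : Cube n → ℝ) : coeff f ∅ = expect f := by simp [coeff]

theorem walsh_flip_singleton (S : Finset (Fin n)) (i : Fin n) (x : Cube n) :
    walsh S (flip {i} x) = if i ∈ S then -walsh S x else walsh S x := by
  unfold walsh
  split_ifs with h
  · rw [← mul_prod_erase _ _ h, ← mul_prod_erase _ _ h, ← neg_mul]
    congr 1
    · simp [flip]
    · refine prod_congr rfl fun k hk => ?_
      simp [flip, (mem_erase.1 hk).1]
  · refine prod_congr rfl fun k hk => ?_
    have : k ≠ i := fun e => h (e ▸ hk)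
    simp [flip, this]

theorem walsh_mul_self (S : Finset (Fin n)) (x : Cube n) : walsh S x * walsh S x = 1 := by
  simp [walsh, ← prod_mul_distrib]

theorem coeff_walsh (S T : Finset (Fin n)) : coeff (walsh S) T = if S = T then 1 else 0 := by
  split_ifs with h
  · subst h
    simp [coeff, walsh_mul_self, expect_const]
  · obtain ⟨i, hi⟩ : (symmDiff S T).Nonempty := by
      rwa [nonempty_iff_ne_empty, ← bot_eq_empty, Ne, symmDiff_eq_bot]
    refine expect_eq_zero_of_flip {i} fun x => ?_
    rw [walsh_flip_singleton, walsh_flip_singleton]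
    rcases mem_symmDiff.1 hi with ⟨h1, h2⟩ | ⟨h1, h2⟩ <;> simp [h1, h2]

theorem walsh_mul_rad (S : Finset (Fin n)) (j : Fin n) (x : Cube n) :
    rad (x j) * walsh S x = walsh (symmDiff S {j}) x := by
  by_cases h : j ∈ S
  · have : symmDiff S {j} = S.erase j := by
      ext k; simp only [mem_symmDiff, mem_singleton, mem_erase]; grind
    rw [this, walsh, walsh, ← mul_prod_erase _ _ h, ← mul_assoc, rad_mul_self, one_mul]
  · have : symmDiff S {j} = insert j S := by
      ext k; simp only [mem_symmDiff, mem_singleton, mem_insert]; grind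
    rw [this, walsh, walsh, prod_insert h]

theorem coeff_mul_rad (f : Cube n → ℝ) (j : Fin n) (S : Finset (Fin n)) :
    coeff (fun x => f x * rad (x j)) S = coeff f (symmDiff S {j}) := by
  simp only [coeff, mul_assoc, walsh_mul_rad]

/-- The kernel of the noise operator `noiseOp ρ` with respect to the uniform measure. -/
noncomputable def noiseKernel (ρ : Fin n → ℝ) (x y : Cube n) : ℝ :=
  ∏ i, (1 + ρ i * (rad (x i) * rad (y i)))

/-- The noise operator with correlation `ρ i` at coordinate `i`. It multiplies the Walsh function
of `S` by `∏ i ∈ S, ρ i`; for `ρ` the indicator function of a set `J` of coordinates it is the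
conditional expectation given the coordinates in `J`. -/
noncomputable def noiseOp (ρ : Fin n → ℝ) (f : Cube n → ℝ) (x : Cube n) : ℝ :=
  expect fun y => noiseKernel ρ x y * f y

theorem noiseKernel_eq_sum (ρ : Fin n → ℝ) (x y : Cube n) :
    noiseKernel ρ x y = ∑ S, (∏ i ∈ S, ρ i) * (walsh S x * walsh S y) := by
  simp [noiseKernel, prod_one_add, walsh, prod_mul_distrib]

theorem noiseOp_eq_sum (ρ : Fin n → ℝ) (f : Cube n → ℝ) (x : Cube n) :
    noiseOp ρ f x = ∑ S, (∏ i ∈ S, ρ i) * coeff f S * walsh S x := by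
  simp only [noiseOp, noiseKernel_eq_sum, sum_mul]
  rw [expect_sum]
  refine sum_congr rfl fun S _ => ?_
  rw [coeff, mul_right_comm, ← expect_const_mul]
  congr 1
  funext y
  ring

theorem noiseKernel_one (x y : Cube n) :
    noiseKernel (fun _ => 1) x y = if x = y then 2 ^ n else 0 := by
  split_ifs with h
  · subst h
    simp [noiseKernel, one_add_one_eq_two]
  · obtain ⟨i, hi⟩ := Function.ne_iff.1 h
    refine prod_eq_zero (mem_univ i) ?_
    cases hx : x i <;> cases hy : y i <;> simp_all

/-- Fourier inversion. -/
theorem eq_sum_coeff (f : Cube n → ℝ) (x : Cube n) : f x = ∑ S, coeff f S * walsh S x := by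
  have h := noiseOp_eq_sum (fun _ => 1) f x
  simp only [prod_const_one, one_mul] at h
  rw [← h]
  simp [noiseOp, noiseKernel_one, expect]

/-- Parseval's identity. -/
theorem expect_mul_eq_sum (f g : Cube n → ℝ) :
    (expect fun x => f x * g x) = ∑ S, coeff f S * coeff g S := by
  conv_lhs => enter [1, x]; rw [eq_sum_coeff f x, sum_mul]
  rw [expect_sum]
  refine sum_congr rfl fun S _ => ?_
  rw [coeff.eq_1 g, ← expect_const_mul]
  congr 1
  funext x
  ring

theorem expect_sq_eq_sum (f : Cube n → ℝ) :
    (expect fun x => f x ^ 2) = ∑ S, coeff f S ^ 2 := by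
  simp only [sq, expect_mul_eq_sum]

theorem coeff_sum {ι : Type*} (s : Finset ι) (a : ι → ℝ) (g : ι → Cube n → ℝ)
    (T : Finset (Fin n)) :
    coeff (fun x => ∑ i ∈ s, a i * g i x) T = ∑ i ∈ s, a i * coeff (g i) T := by
  simp only [coeff, sum_mul]
  rw [expect_sum]
  simp only [← expect_const_mul, mul_assoc]

theorem coeff_noiseOp (ρ : Fin n → ℝ) (f : Cube n → ℝ) (T : Finset (Fin n)) :
    coeff (noiseOp ρ f) T = (∏ i ∈ T, ρ i) * coeff f T := by
  have h : noiseOp ρ f = fun x => ∑ S, ((∏ i ∈ S, ρ i) * coeff f S) * walsh S x :=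
    funext (noiseOp_eq_sum ρ f)
  rw [h, coeff_sum]
  simp [coeff_walsh]

theorem expect_noiseOp_mul (ρ : Fin n → ℝ) (f g : Cube n → ℝ) :
    (expect fun x => noiseOp ρ f x * g x) = expect fun x => f x * noiseOp ρ g x := by
  simp only [expect_mul_eq_sum, coeff_noiseOp]
  exact sum_congr rfl fun S _ => by ring

theorem noiseWeight_eq (ε : ℝ) (x y : Cube n) :
    noiseWeight ε x y = noiseKernel (fun _ => 1 - 2 * ε) x y / 2 ^ n := by
  have h : (2 : ℝ) ^ n = ∏ _i : Fin n, (2 : ℝ) := by simp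
  rw [noiseWeight, noiseKernel, h, ← prod_div_distrib]
  refine prod_congr rfl fun i _ => ?_
  cases hx : x i <;> cases hy : y i <;> simp <;> ring

theorem sum_noiseWeight_mul (ε : ℝ) (f : Cube n → ℝ) (x : Cube n) :
    ∑ y, noiseWeight ε x y * f y = noiseOp (fun _ => 1 - 2 * ε) f x := by
  simp only [noiseWeight_eq, noiseOp, expect, sum_div]
  exact sum_congr rfl fun y _ => by ring

theorem noiseProb_eq (A : Set (Cube n)) (ε : ℝ) (x : Cube n) :
    noiseProb A ε x = noiseOp (fun _ => 1 - 2 * ε) (chi A) x :=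
  sum_noiseWeight_mul ε (chi A) x

theorem sum_noiseWeight (ε : ℝ) (x : Cube n) : ∑ y, noiseWeight ε x y = 1 := by
  have h := sum_noiseWeight_mul ε (fun _ => 1) x
  simp only [mul_one] at h
  have h1 : (fun _ : Cube n => (1 : ℝ)) = walsh ∅ := by funext y; simp
  rw [h, noiseOp_eq_sum, h1]
  simp [coeff_walsh]

/-! ### Hypercontractivity -/

theorem expect_cons (f : Cube (n + 1) → ℝ) :
    expect f = ((expect fun x => f (Fin.cons true x)) +
      expect fun x => f (Fin.cons false x)) / 2 := by
  have h : ∑ x, f x = ∑ p : Bool × Cube n, f (Fin.cons p.1 p.2) :=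
    ((Fin.consEquiv fun _ : Fin (n + 1) => Bool).sum_comp f).symm
  simp only [expect, h, Fintype.sum_prod_type, Fintype.sum_bool]
  rw [pow_succ]
  field_simp

theorem noiseOp_cons (ρ : ℝ) (f : Cube (n + 1) → ℝ) (b : Bool) (x : Cube n) :
    noiseOp (fun _ => ρ) f (Fin.cons b x) =
      ((1 + ρ * rad b) * noiseOp (fun _ => ρ) (fun y => f (Fin.cons true y)) x +
        (1 - ρ * rad b) * noiseOp (fun _ => ρ) (fun y => f (Fin.cons false y)) x) / 2 := by
  simp only [noiseOp]
  rw [expect_cons, ← expect_const_mul, ← expect_const_mul]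
  simp [noiseKernel, Fin.prod_univ_succ, mul_assoc, sub_eq_add_neg]

theorem noiseOp_add (ρ : Fin n → ℝ) (f g : Cube n → ℝ) (x : Cube n) :
    noiseOp ρ (fun y => f y + g y) x = noiseOp ρ f x + noiseOp ρ g x := by
  simp only [noiseOp, mul_add, expect_add]

theorem noiseOp_const_mul (ρ : Fin n → ℝ) (c : ℝ) (f : Cube n → ℝ) (x : Cube n) :
    noiseOp ρ (fun y => c * f y) x = c * noiseOp ρ f x := by
  simp only [noiseOp, ← expect_const_mul, mul_left_comm]

/-- The Bonami–Beckner `(2, 4)`-hypercontractive inequality, by induction on the dimension. -/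
theorem hypercontractive {ρ : ℝ} (hρ : ρ ^ 2 = 1 / 3) :
    ∀ {n : ℕ} (f : Cube n → ℝ),
      (expect fun x => noiseOp (fun _ => ρ) f x ^ 4) ≤ (expect fun x => f x ^ 2) ^ 2
  | 0, f => by
    refine le_of_eq ?_
    simp [expect, noiseOp, noiseKernel]
    ring
  | n + 1, f => by
    -- The mean and the half-difference of the two restrictions of `f`.
    set e : Cube n → ℝ := fun x => 1 / 2 * f (Fin.cons true x) + 1 / 2 * f (Fin.cons false x)
      with he
    set d : Cube n → ℝ := fun x => 1 / 2 * f (Fin.cons true x) + -1 / 2 * f (Fin.cons false x)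
      with hd
    have hTe : ∀ x, noiseOp (fun _ => ρ) e x =
        1 / 2 * noiseOp (fun _ => ρ) (fun y => f (Fin.cons true y)) x +
        1 / 2 * noiseOp (fun _ => ρ) (fun y => f (Fin.cons false y)) x := fun x => by
      rw [he, noiseOp_add, noiseOp_const_mul, noiseOp_const_mul]
    have hTd : ∀ x, noiseOp (fun _ => ρ) d x =
        1 / 2 * noiseOp (fun _ => ρ) (fun y => f (Fin.cons true y)) x +
        -1 / 2 * noiseOp (fun _ => ρ) (fun y => f (Fin.cons false y)) x := fun x => by
      rw [hd, noiseOp_add, noiseOp_const_mul, noiseOp_const_mul]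
    have ihe := hypercontractive hρ e
    have ihd := hypercontractive hρ d
    set u := noiseOp (fun _ => ρ) e with hu
    set v := noiseOp (fun _ => ρ) d with hv
    have hcons : ∀ b x, noiseOp (fun _ => ρ) f (Fin.cons b x) = u x + ρ * rad b * v x := by
      intro b x
      rw [noiseOp_cons, hTe, hTd]
      ring
    have hρ4 : ρ ^ 4 = 1 / 9 := by
      rw [show ρ ^ 4 = (ρ ^ 2) ^ 2 by ring, hρ]; norm_num
    have hL : (expect fun x => noiseOp (fun _ => ρ) f x ^ 4) =
        (expect fun x => u x ^ 4) + 2 * (expect fun x => u x ^ 2 * v x ^ 2) +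
          1 / 9 * expect fun x => v x ^ 4 := by
      rw [expect_cons, ← expect_add, div_eq_mul_inv, ← expect_mul_const, ← expect_const_mul,
        ← expect_const_mul, ← expect_add, ← expect_add]
      congr 1
      funext x
      rw [hcons, hcons, rad_true, rad_false]
      linear_combination (6 * u x ^ 2 * v x ^ 2) * hρ + v x ^ 4 * hρ4
    have hR : (expect fun x => f x ^ 2) =
        (expect fun x => e x ^ 2) + expect fun x => d x ^ 2 := by
      rw [expect_cons, ← expect_add, ← expect_add, div_eq_mul_inv, ← expect_mul_const]
      congr 1
      funext x
      simp only [he, hd]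
      ring
    have hE : 0 ≤ expect fun x => e x ^ 2 := expect_nonneg fun x => sq_nonneg _
    have hD : 0 ≤ expect fun x => d x ^ 2 := expect_nonneg fun x => sq_nonneg _
    have hV : 0 ≤ expect fun x => v x ^ 4 := expect_nonneg fun x => by positivity
    have hUV : (expect fun x => u x ^ 2 * v x ^ 2) ≤
        (expect fun x => e x ^ 2) * expect fun x => d x ^ 2 := by
      refine (le_abs_self _).trans (abs_le_of_sq_le_sq ?_ (mul_nonneg hE hD))
      refine (expect_mul_sq_le _ _).trans ?_
      simp only [← pow_mul]
      rw [mul_pow]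
      exact mul_le_mul ihe ihd hV (by positivity)
    rw [hL, hR]
    nlinarith

/-- For nonnegative `h` the hypercontractive inequality bounds the `L²` norm of `T h` by the
geometric mean of the `L¹` and `L²` norms of `h`. -/
theorem expect_noiseOp_sq_le {ρ : ℝ} (hρ : ρ ^ 2 = 1 / 3) {h : Cube n → ℝ} (h0 : ∀ x, 0 ≤ h x) :
    (expect fun x => noiseOp (fun _ => ρ) h x ^ 2) ≤
      expect h * √(expect fun x => h x ^ 2) := by
  set u := noiseOp (fun _ => ρ) (noiseOp (fun _ => ρ) h) with hu
  set B := expect fun x => noiseOp (fun _ => ρ) h x ^ 2 with hB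
  have hBu : B = expect fun x => h x * u x := by
    rw [hB, hu, ← expect_noiseOp_mul]
    simp only [sq]
  have hB0 : 0 ≤ B := expect_nonneg fun x => sq_nonneg _
  have h10 : 0 ≤ expect h := expect_nonneg h0
  have h20 : 0 ≤ expect fun x => h x ^ 2 := expect_nonneg fun x => sq_nonneg _
  have hu4 : (expect fun x => u x ^ 4) ≤ B ^ 2 := hypercontractive hρ _
  have hC : 0 ≤ expect fun x => h x * u x ^ 2 :=
    expect_nonneg fun x => mul_nonneg (h0 x) (sq_nonneg _)
  have h1 : B ^ 2 ≤ expect h * expect fun x => h x * u x ^ 2 := by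
    have := expect_mul_sq_le (fun x => √(h x)) (fun x => √(h x) * u x)
    simp only [mul_pow, Real.sq_sqrt (h0 _), ← mul_assoc, Real.mul_self_sqrt (h0 _)] at this
    rwa [← hBu] at this
  have h2 : (expect fun x => h x * u x ^ 2) ≤ √(expect fun x => h x ^ 2) * B := by
    refine (le_abs_self _).trans (abs_le_of_sq_le_sq ?_ (by positivity))
    refine (expect_mul_sq_le _ _).trans ?_
    rw [mul_pow, Real.sq_sqrt h20]
    simp only [← pow_mul]
    exact mul_le_mul_of_nonneg_left hu4 h20
  rcases hB0.eq_or_lt with hz | hpos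
  · rw [← hz]; positivity
  · refine le_of_mul_le_mul_right ?_ hpos
    calc B * B = B ^ 2 := (sq B).symm
      _ ≤ expect h * expect fun x => h x * u x ^ 2 := h1
      _ ≤ expect h * (√(expect fun x => h x ^ 2) * B) := by gcongr
      _ = _ := by ring

/-- The Khinchine inequality for the fourth moment, with the constant `9`. -/
theorem expect_linear_pow_four_le (p : Fin n → ℝ) :
    (expect fun x => (∑ j, p j * rad (x j)) ^ 4) ≤ 9 * (∑ j, p j ^ 2) ^ 2 := by
  set L : Cube n → ℝ := fun x => ∑ j, p j * walsh {j} x with hL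
  have hc : ∀ S, coeff L S = ∑ j, p j * if {j} = S then 1 else 0 := fun S => by
    simp only [hL, coeff_sum, coeff_walsh]
  have h2 : (expect fun x => L x ^ 2) = ∑ j, p j ^ 2 := by
    rw [show (fun x => L x ^ 2) = fun x => ∑ j, p j * (L x * walsh {j} x) by
      funext x; rw [sq]; nth_rw 2 [hL]; rw [mul_sum]; exact sum_congr rfl fun j _ => by ring]
    rw [expect_sum]
    refine sum_congr rfl fun j _ => ?_
    rw [expect_const_mul, ← coeff.eq_1, hc]
    simp [sq]
  obtain ⟨ρ, hρ⟩ : ∃ ρ : ℝ, ρ ^ 2 = 1 / 3 := ⟨√(1 / 3), Real.sq_sqrt (by norm_num)⟩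
  have hT : ∀ x, noiseOp (fun _ => ρ) L x = ρ * L x := by
    intro x
    rw [noiseOp_eq_sum]
    conv_rhs => rw [eq_sum_coeff L x, mul_sum]
    refine sum_congr rfl fun S _ => ?_
    rw [prod_const, mul_assoc]
    by_cases hS : S.card = 1
    · rw [hS, pow_one]
    · have : coeff L S = 0 := by
        rw [hc]
        refine sum_eq_zero fun j _ => ?_
        rw [if_neg, mul_zero]
        rintro rfl
        simp at hS
      simp [this]
  have h4 := hypercontractive hρ L
  simp only [hT, mul_pow, expect_const_mul, h2] at h4
  rw [show ρ ^ 4 = 1 / 9 by rw [show ρ ^ 4 = (ρ ^ 2) ^ 2 by ring, hρ]; norm_num] at h4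
  simp only [hL, walsh_singleton] at h4
  linarith

theorem expect_linear_sq (p : Fin n → ℝ) :
    (expect fun x => (∑ j, p j * rad (x j)) ^ 2) = ∑ j, p j ^ 2 := by
  have key : ∀ i j : Fin n, (expect fun x => rad (x i) * rad (x j)) = if i = j then 1 else 0 := by
    intro i j
    have := coeff_walsh {i} {j}
    simpa [coeff] using this
  simp only [sq, sum_mul_sum]
  rw [expect_sum]
  refine sum_congr rfl fun i _ => ?_
  rw [expect_sum]
  have : ∀ j, (expect fun x : Cube n => p i * rad (x i) * (p j * rad (x j))) =
      p i * p j * if i = j then 1 else 0 := by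
    intro j
    rw [← key, ← expect_const_mul]
    congr 1
    funext x
    ring
  simp [this]

/-! ### The first Fourier level of a monotone function controls its noise sensitivity -/

/-- The parameters of the conditional expectation given the coordinates outside `I`. -/
def outside (I : Finset (Fin n)) (i : Fin n) : ℝ := if i ∈ I then 0 else 1

theorem prod_outside (I S : Finset (Fin n)) :
    ∏ i ∈ S, outside I i = if Disjoint S I then 1 else 0 := by
  split_ifs with h
  · exact prod_eq_one fun i hi => if_neg (disjoint_left.1 h hi)
  · obtain ⟨i, hi, hi'⟩ := not_disjoint_iff.1 h
    exact prod_eq_zero hi (if_pos hi')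

theorem outside_kernel_nonneg (I : Finset (Fin n)) (x y : Cube n) :
    0 ≤ noiseKernel (outside I) x y := by
  refine prod_nonneg fun i _ => ?_
  unfold outside
  split_ifs
  · simp
  · cases x i <;> cases y i <;> norm_num

/-- For monotone `f` and `j ∈ I`, the conditional covariance of `f` with the bit `j`, given the
coordinates outside `I`, is nonnegative. -/
theorem noiseOp_outside_mul_rad_nonneg {f : Cube n → ℝ} (hf : Monotone f) {I : Finset (Fin n)}
    {j : Fin n} (hj : j ∈ I) (x : Cube n) :
    0 ≤ noiseOp (outside I) (fun y => f y * rad (y j)) x := by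
  set F : Cube n → ℝ := fun y => noiseKernel (outside I) x y * (f y * rad (y j)) with hF
  have hk : ∀ y, noiseKernel (outside I) x (flip {j} y) = noiseKernel (outside I) x y := by
    intro y
    refine prod_congr rfl fun i _ => ?_
    by_cases hi : i = j
    · subst hi; simp [outside, hj]
    · simp [flip, hi]
  -- Pair each point with its neighbour in direction `j`.
  have hsum : (expect F + expect F) = expect fun y => F y + F (flip {j} y) := by
    rw [expect_add, expect_flip]
  have hnn : ∀ y, 0 ≤ F y + F (flip {j} y) := by
    intro y
    have hr : rad (flip {j} y j) = -rad (y j) := by simp [flip]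
    have : F y + F (flip {j} y) =
        noiseKernel (outside I) x y * ((f y - f (flip {j} y)) * rad (y j)) := by
      simp only [hF, hk, hr]; ring
    rw [this]
    refine mul_nonneg (outside_kernel_nonneg I x y) ?_
    cases hy : y j
    · have : f y ≤ f (flip {j} y) := by
        refine hf fun i => ?_
        by_cases hi : i = j
        · subst hi; simp [hy]
        · simp [flip, hi]
      simp only [rad_false]
      linarith
    · have : f (flip {j} y) ≤ f y := by
        refine hf fun i => ?_
        by_cases hi : i = j
        · subst hi; simp [hy]
        · simp [flip, hi]
      simp only [rad_true]
      linarith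
  have := expect_nonneg hnn
  change 0 ≤ expect F
  linarith

theorem symmDiff_singleton_disjoint_iff {I : Finset (Fin n)} {j : Fin n} (hj : j ∈ I)
    (U : Finset (Fin n)) : Disjoint (symmDiff U {j}) I ↔ U ∩ I = {j} := by
  rw [disjoint_left, Finset.ext_iff]
  refine forall_congr' fun i => ?_
  simp only [mem_symmDiff, mem_singleton, mem_inter]
  by_cases hi : i = j
  · subst hi; tauto
  · tauto

theorem card_symmDiff_singleton_le {I U : Finset (Fin n)} {j : Fin n} (h : U ∩ I = {j}) :
    (symmDiff U {j}).card ≤ U.card := by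
  have hj : j ∈ U := (mem_inter.1 (h ▸ mem_singleton_self j)).1
  refine card_le_card fun i hi => ?_
  simp only [mem_symmDiff, mem_singleton] at hi
  rcases hi with hi | ⟨rfl, _⟩
  · exact hi.1
  · exact hj

theorem sum_ite_inter_eq_singleton (I : Finset (Fin n)) (F : Finset (Fin n) → ℝ) :
    ∑ j ∈ I, ∑ U, (if U ∩ I = {j} then F U else 0) =
      ∑ U, if (U ∩ I).card = 1 then F U else 0 := by
  rw [sum_comm]
  refine sum_congr rfl fun U _ => ?_
  split_ifs with h
  · obtain ⟨j, hj⟩ := card_eq_one.1 h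
    have hjI : j ∈ I := (mem_inter.1 (hj ▸ mem_singleton_self j)).2
    rw [sum_eq_single_of_mem j hjI, if_pos hj]
    intro i _ hi
    rw [if_neg]
    rw [hj, singleton_inj]
    exact fun e => hi e.symm
  · refine sum_eq_zero fun j _ => if_neg fun e => h ?_
    rw [e, card_singleton]

/-- The total squared weight on the first Fourier level. -/
noncomputable def levelOne (f : Cube n → ℝ) : ℝ := ∑ j, coeff f {j} ^ 2

theorem levelOne_nonneg (f : Cube n → ℝ) : 0 ≤ levelOne f := sum_nonneg fun _ _ => sq_nonneg _

/-- For a set `I` of coordinates, the weighted Fourier mass of a monotone function on the sets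
that meet `I` in exactly one point is controlled by its first level. The conditional covariances
`h j` with the bits `j ∈ I` have means `coeff f {j}`, and the sum of their second moments is at
most one because each set `U` is counted for only one `j`; hypercontractivity interpolates
between these two facts. -/
theorem sum_inter_card_one_le {f : Cube n → ℝ} (hf : Monotone f)
    (hf1 : (expect fun x => f x ^ 2) ≤ 1) (I : Finset (Fin n)) :
    (∑ U, if (U ∩ I).card = 1 then (1 / 3 : ℝ) ^ U.card * coeff f U ^ 2 else 0) ≤
      √(levelOne f) := by
  obtain ⟨ρ, hρ⟩ : ∃ ρ : ℝ, ρ ^ 2 = 1 / 3 := ⟨√(1 / 3), Real.sq_sqrt (by norm_num)⟩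
  set h : Fin n → Cube n → ℝ := fun j => noiseOp (outside I) fun y => f y * rad (y j) with hh
  have hcoeff : ∀ j S, coeff (h j) S =
      if Disjoint S I then coeff f (symmDiff S {j}) else 0 := by
    intro j S
    rw [hh, coeff_noiseOp, prod_outside, coeff_mul_rad]
    simp
  have hshift : ∀ (j : Fin n) (F : Finset (Fin n) → ℝ),
      ∑ S, F S = ∑ U, F (symmDiff U {j}) := fun j F =>
    (Equiv.sum_comp (symmDiff_left_involutive ({j} : Finset (Fin n))).toPerm F).symm
  have hmean : ∀ j, expect (h j) = coeff f {j} := by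
    intro j
    rw [← coeff_empty, hcoeff, if_pos (disjoint_empty_left I), ← bot_eq_empty, bot_symmDiff]
  have hsq : ∀ j ∈ I, (expect fun x => h j x ^ 2) =
      ∑ U, if U ∩ I = {j} then coeff f U ^ 2 else 0 := by
    intro j hj
    rw [expect_sq_eq_sum, hshift j]
    refine sum_congr rfl fun U _ => ?_
    rw [hcoeff, symmDiff_symmDiff_cancel_right, ite_pow, zero_pow two_ne_zero]
    simp only [symmDiff_singleton_disjoint_iff hj]
  have hT : ∀ j ∈ I, (∑ U, if U ∩ I = {j} then (1 / 3 : ℝ) ^ U.card * coeff f U ^ 2 else 0) ≤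
      expect fun x => noiseOp (fun _ => ρ) (h j) x ^ 2 := by
    intro j hj
    rw [expect_sq_eq_sum, hshift j fun S => coeff (noiseOp (fun _ => ρ) (h j)) S ^ 2]
    refine sum_le_sum fun U _ => ?_
    rw [coeff_noiseOp, hcoeff, symmDiff_symmDiff_cancel_right]
    simp only [symmDiff_singleton_disjoint_iff hj]
    split_ifs with hU
    · rw [mul_pow, prod_const, ← pow_mul, mul_comm _ 2, pow_mul, hρ]
      gcongr ?_ * _
      exact pow_le_pow_of_le_one (by norm_num) (by norm_num) (card_symmDiff_singleton_le hU)
    · exact sq_nonneg _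
  have htotal : (∑ j ∈ I, expect fun x => h j x ^ 2) ≤ 1 := by
    rw [sum_congr rfl hsq, sum_ite_inter_eq_singleton]
    refine le_trans (sum_le_sum fun U _ => ?_) ((expect_sq_eq_sum f).symm.trans_le hf1)
    split_ifs
    · exact le_rfl
    · exact sq_nonneg _
  have h20 : ∀ j, 0 ≤ expect fun x => h j x ^ 2 := fun j => expect_nonneg fun x => sq_nonneg _
  rw [← sum_ite_inter_eq_singleton]
  calc ∑ j ∈ I, ∑ U, (if U ∩ I = {j} then (1 / 3 : ℝ) ^ U.card * coeff f U ^ 2 else 0)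
      ≤ ∑ j ∈ I, coeff f {j} * √(expect fun x => h j x ^ 2) := by
        refine sum_le_sum fun j hj => (hT j hj).trans ?_
        rw [← hmean]
        exact expect_noiseOp_sq_le hρ fun x => noiseOp_outside_mul_rad_nonneg hf hj x
    _ ≤ √(∑ j ∈ I, coeff f {j} ^ 2) * √(∑ j ∈ I, √(expect fun x => h j x ^ 2) ^ 2) :=
        Real.sum_mul_le_sqrt_mul_sqrt _ _ _
    _ ≤ √(levelOne f) * √1 := by
        gcongr
        · exact sum_le_univ_sum_of_nonneg fun j => sq_nonneg _
        · simpa only [Real.sq_sqrt (h20 _)] using htotal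
    _ = √(levelOne f) := by simp

theorem two_pow_le_card_inter_card_one {U : Finset (Fin n)} (hU : U.Nonempty) :
    (2 : ℝ) ^ n * (1 / 2) ^ U.card ≤ ∑ I : Finset (Fin n), if (U ∩ I).card = 1 then 1 else 0 := by
  obtain ⟨j, hj⟩ := hU
  have hcard : (Uᶜ).powerset.card ≤ (univ.filter fun I => (U ∩ I).card = 1).card := by
    refine card_le_card_of_injOn (fun K => insert j K) ?_ ?_
    · intro K hK
      have hK' : K ⊆ Uᶜ := mem_powerset.1 hK
      simp only [coe_filter, mem_univ, true_and, Set.mem_ofPred_eq]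
      rw [card_eq_one]
      refine ⟨j, ?_⟩
      ext i
      simp only [mem_inter, mem_insert, mem_singleton]
      refine ⟨?_, ?_⟩
      · rintro ⟨hi, rfl | hi'⟩
        · rfl
        · exact absurd hi (mem_compl.1 (hK' hi'))
      · rintro rfl
        exact ⟨hj, Or.inl rfl⟩
    · intro K hK K' hK' e
      have hjK : ∀ {K : Finset (Fin n)}, K ∈ (Uᶜ).powerset → j ∉ K := fun h hjK =>
        mem_compl.1 (mem_powerset.1 h hjK) hj
      have := congrArg (fun s => s.erase j) e
      simpa [erase_insert (hjK hK), erase_insert (hjK hK')] using this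
  rw [card_powerset, card_compl, Fintype.card_fin] at hcard
  have hUn : U.card ≤ n := by simpa using card_le_univ U
  rw [sum_boole]
  calc (2 : ℝ) ^ n * (1 / 2) ^ U.card = 2 ^ (n - U.card) := by
        rw [pow_sub₀ _ two_ne_zero hUn, one_div, inv_pow]
    _ ≤ _ := by exact_mod_cast hcard

/-- Averaging over `I` the bound for the sets that meet `I` in one point. -/
theorem sum_nonempty_le {f : Cube n → ℝ} (hf : Monotone f)
    (hf1 : (expect fun x => f x ^ 2) ≤ 1) :
    ∑ U ∈ univ.filter (fun U : Finset (Fin n) => U.Nonempty), (1 / 6 : ℝ) ^ U.card * coeff f U ^ 2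
      ≤ √(levelOne f) := by
  have h1 : ∑ I : Finset (Fin n),
      (∑ U, if (U ∩ I).card = 1 then (1 / 3 : ℝ) ^ U.card * coeff f U ^ 2 else 0) ≤
      ∑ _I : Finset (Fin n), √(levelOne f) := sum_le_sum fun I _ => sum_inter_card_one_le hf hf1 I
  rw [sum_const, card_univ, Fintype.card_finset, Fintype.card_fin, nsmul_eq_mul, sum_comm] at h1
  push_cast at h1
  refine le_of_mul_le_mul_left (le_trans ?_ h1) (by positivity : (0 : ℝ) < 2 ^ n)
  rw [mul_sum]
  refine le_trans (sum_le_sum fun U hU => ?_)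
    (sum_le_univ_sum_of_nonneg fun U => sum_nonneg fun I _ => by split_ifs <;> positivity)
  have h2 := two_pow_le_card_inter_card_one (mem_filter.1 hU).2
  calc (2 : ℝ) ^ n * ((1 / 6) ^ U.card * coeff f U ^ 2)
      = (2 ^ n * (1 / 2) ^ U.card) * ((1 / 3) ^ U.card * coeff f U ^ 2) := by
        rw [show (1 / 6 : ℝ) = 1 / 2 * (1 / 3) by norm_num, mul_pow]; ring
    _ ≤ (∑ I : Finset (Fin n), if (U ∩ I).card = 1 then 1 else 0) *
        ((1 / 3) ^ U.card * coeff f U ^ 2) := by gcongr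
    _ = _ := by
        rw [sum_mul]
        exact sum_congr rfl fun I _ => by split_ifs <;> simp

/-- The variance of `T f` is small when the first Fourier level of the monotone function `f` is:
the levels above `D` are damped by the noise, and the levels from `1` to `D` are controlled by
the first one. -/
theorem expect_noiseOp_sub_sq_le {f : Cube n → ℝ} (hf : Monotone f)
    (hf1 : (expect fun x => f x ^ 2) ≤ 1) {ρ : ℝ} (hρ0 : 0 ≤ ρ) (hρ1 : ρ ≤ 1) (D : ℕ) :
    (expect fun x => (noiseOp (fun _ => ρ) f x - expect f) ^ 2) ≤
      ρ ^ D + 6 ^ D * √(levelOne f) := by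
  have hcoeff : ∀ S, coeff (fun x => noiseOp (fun _ => ρ) f x - expect f) S =
      if S.Nonempty then ρ ^ S.card * coeff f S else 0 := by
    intro S
    have h1 : coeff (fun x => noiseOp (fun _ => ρ) f x - expect f) S =
        coeff (noiseOp (fun _ => ρ) f) S - expect f * coeff (walsh ∅) S := by
      simp only [coeff, sub_mul, walsh_empty, one_mul]
      rw [expect_sub, expect_const_mul]
    rw [h1, coeff_noiseOp, coeff_walsh, prod_const]
    rcases S.eq_empty_or_nonempty with rfl | hS
    · simp [coeff_empty]
    · simp [hS, hS.ne_empty.symm]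
  rw [expect_sq_eq_sum]
  have hterm : ∀ S : Finset (Fin n), coeff (fun x => noiseOp (fun _ => ρ) f x - expect f) S ^ 2 ≤
      ρ ^ D * coeff f S ^ 2 +
        6 ^ D * if S.Nonempty then (1 / 6 : ℝ) ^ S.card * coeff f S ^ 2 else 0 := by
    intro S
    rw [hcoeff]
    split_ifs with hS
    · rw [mul_pow, ← mul_assoc, ← add_mul]
      gcongr
      rcases le_total D S.card with h | h
      · have h1 : (ρ ^ S.card) ^ 2 ≤ ρ ^ D := by
          rw [← pow_mul]
          exact pow_le_pow_of_le_one hρ0 hρ1 (by omega)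
        have : (0 : ℝ) ≤ 6 ^ D * (1 / 6) ^ S.card := by positivity
        linarith
      · have h1 : (ρ ^ S.card) ^ 2 ≤ 1 := pow_le_one₀ (by positivity) (pow_le_one₀ hρ0 hρ1)
        have h2 : (1 : ℝ) ≤ 6 ^ D * (1 / 6) ^ S.card := by
          rw [one_div, inv_pow, ← div_eq_mul_inv, one_le_div (by positivity)]
          exact pow_le_pow_right₀ (by norm_num) h
        have : 0 ≤ ρ ^ D := by positivity
        linarith
    · have : 0 ≤ ρ ^ D * coeff f S ^ 2 := by positivity
      simpa using this
  refine (sum_le_sum fun S _ => hterm S).trans ?_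
  rw [sum_add_distrib, ← mul_sum, ← mul_sum, ← sum_filter, ← expect_sq_eq_sum]
  have := sum_nonempty_le hf hf1
  have hρD : 0 ≤ ρ ^ D := by positivity
  gcongr
  exact mul_le_of_le_one_right hρD hf1

/-! ### The first Fourier level is controlled by weighted majorities -/

theorem weightedMajority_eq (w : Fin n → ℝ) (x : Cube n) :
    weightedMajority w x = Real.sign (∑ j, w j * rad (x j)) := by
  simp only [weightedMajority, two_mul_toNat_sub_one, mul_comm (w _)]

theorem abs_sign_le_one (t : ℝ) : |Real.sign t| ≤ 1 := by
  rcases Real.sign_apply_eq t with h | h | h <;> simp [h]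

/-- The averaging operator of one step of the walk on `ℝ` with steps `±1` of mean `q`. -/
noncomputable def walk (q : ℝ) (g : ℝ → ℝ) (s : ℝ) : ℝ :=
  (1 + q) / 2 * g (s + 1) + (1 - q) / 2 * g (s - 1)

/-- A step along a random coordinate of `x`, chosen with distribution `p`, is a step of the walk
whose mean is the linear function of `x` with weights `p`. -/
theorem walk_linear {p : Fin n → ℝ} (hp : ∑ j, p j = 1) (x : Cube n) (g : ℝ → ℝ) (s : ℝ) :
    walk (∑ j, p j * rad (x j)) g s = ∑ j, p j * g (s + rad (x j)) := by
  have h : ∀ j, p j * g (s + rad (x j)) =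
      (p j + p j * rad (x j)) * (g (s + 1) / 2) + (p j - p j * rad (x j)) * (g (s - 1) / 2) := by
    intro j
    cases x j <;> simp [sub_eq_add_neg] <;> ring
  simp only [h]
  rw [sum_add_distrib, ← sum_mul, ← sum_mul, sum_add_distrib, sum_sub_distrib, hp, walk]
  ring

/-- Averaging majorities whose weights are the numbers of visits of `k` random coordinates: the
correlation with the averaged function is bounded by the largest correlation. -/
theorem abs_expect_walk_le {f : Cube n → ℝ} {c : ℝ}
    (hc : ∀ w : Fin n → ℕ, |expect fun x => f x * Real.sign (∑ j, (w j : ℝ) * rad (x j))| ≤ c)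
    {p : Fin n → ℝ} (hp0 : ∀ j, 0 ≤ p j) (hp : ∑ j, p j = 1) (k : ℕ) (w : Fin n → ℕ) :
    |expect fun x => f x * (walk (∑ j, p j * rad (x j)))^[k] Real.sign
      (∑ j, (w j : ℝ) * rad (x j))| ≤ c := by
  induction k generalizing w with
  | zero => exact hc w
  | succ k ih =>
    have hstep : (expect fun x => f x * (walk (∑ j, p j * rad (x j)))^[k + 1] Real.sign
        (∑ j, (w j : ℝ) * rad (x j))) =
        ∑ i, p i * expect fun x => f x * (walk (∑ j, p j * rad (x j)))^[k] Real.sign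
          (∑ j, ((w j + if j = i then 1 else 0 : ℕ) : ℝ) * rad (x j)) := by
      simp only [← expect_const_mul]
      rw [← expect_sum]
      congr 1
      funext x
      rw [Function.iterate_succ_apply', walk_linear hp, mul_sum]
      refine sum_congr rfl fun i _ => ?_
      have : ∑ j, ((w j + if j = i then 1 else 0 : ℕ) : ℝ) * rad (x j) =
          ∑ j, (w j : ℝ) * rad (x j) + rad (x i) := by
        simp [add_mul, sum_add_distrib]
      rw [this]
      ring
    rw [hstep]
    calc _ ≤ ∑ i, |p i * _| := abs_sum_le_sum_abs _ _
      _ ≤ ∑ i, p i * c := by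
        refine sum_le_sum fun i _ => ?_
        rw [abs_mul, abs_of_nonneg (hp0 i)]
        exact mul_le_mul_of_nonneg_left (ih _) (hp0 i)
      _ = c := by rw [← sum_mul, hp, one_mul]

theorem walk_iterate (q : ℝ) (g : ℝ → ℝ) (k : ℕ) (s : ℝ) :
    (walk q)^[k] g s = ∑ ij ∈ antidiagonal k, (k.choose ij.1 : ℝ) *
      (((1 + q) / 2) ^ ij.1 * ((1 - q) / 2) ^ ij.2 * g (s + (ij.1 - ij.2))) := by
  induction k generalizing s with
  | zero => simp
  | succ k ih =>
    rw [Function.iterate_succ_apply', walk, ih, ih,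
      sum_antidiagonal_choose_succ_mul fun i j : ℕ =>
        ((1 + q) / 2) ^ i * ((1 - q) / 2) ^ j * g (s + ((i : ℝ) - j)), add_comm, mul_sum, mul_sum]
    congr 1
    · refine sum_congr rfl fun ij _ => ?_
      rw [show s + ((ij.1 : ℝ) - (ij.2 + 1 : ℕ)) = s - 1 + (ij.1 - ij.2) by push_cast; ring]
      ring
    · refine sum_congr rfl fun ij hij => ?_
      rw [show s + (((ij.1 + 1 : ℕ) : ℝ) - ij.2) = s + 1 + (ij.1 - ij.2) by push_cast; ring,
        Nat.choose_symm_of_eq_add (mem_antidiagonal.1 hij).symm]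
      ring

/-- Two further steps change the expected sign only when they start from `±1`. The hypotheses
on `t` are satisfied by the odd integers other than `±1`. -/
theorem walk_walk_sign_sub {q t : ℝ} (ht : t ≠ 1) (ht' : t ≠ -1) (h : 1 ≤ |t|)
    (hgap : 1 < |t| → 2 < |t|) : walk q (walk q Real.sign) t = Real.sign t := by
  simp only [walk]
  rcases abs_cases t with ⟨e, h0⟩ | ⟨e, h0⟩ <;> rw [e] at h hgap
  · have := hgap (lt_of_le_of_ne h ht.symm)
    rw [Real.sign_of_pos (by linarith : 0 < t), Real.sign_of_pos (by linarith : 0 < t + 1 + 1),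
      Real.sign_of_pos (by linarith : 0 < t + 1 - 1), Real.sign_of_pos (by linarith : 0 < t - 1 + 1),
      Real.sign_of_pos (by linarith : 0 < t - 1 - 1)]
    ring
  · have := hgap (lt_of_le_of_ne h fun e => ht' (by linarith))
    rw [Real.sign_of_neg (by linarith : t < 0), Real.sign_of_neg (by linarith : t + 1 + 1 < 0),
      Real.sign_of_neg (by linarith : t + 1 - 1 < 0), Real.sign_of_neg (by linarith : t - 1 + 1 < 0),
      Real.sign_of_neg (by linarith : t - 1 - 1 < 0)]
    ring

/-- The expected sign of a walk of odd length. -/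
theorem walk_iterate_sign (q : ℝ) (m : ℕ) :
    (walk q)^[2 * m + 1] Real.sign 0 =
      q * ∑ i ∈ range (m + 1), (i.centralBinom : ℝ) / 4 ^ i * (1 - q ^ 2) ^ i := by
  induction m with
  | zero =>
    simp [walk, Real.sign_neg]
    ring
  | succ m ih =>
    have hdiff : (walk q)^[2 * m + 1] (walk q (walk q Real.sign)) 0 -
        (walk q)^[2 * m + 1] Real.sign 0 =
        q * (((m + 1).centralBinom : ℝ) / 4 ^ (m + 1) * (1 - q ^ 2) ^ (m + 1)) := by
      rw [walk_iterate, walk_iterate, ← sum_sub_distrib,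
        ← sum_subset (s₁ := {(m + 1, m), (m, m + 1)})]
      · have h1 : (0 : ℝ) + (((m + 1 : ℕ) : ℝ) - m) = 1 := by push_cast; ring
        have h2 : (0 : ℝ) + ((m : ℝ) - (m + 1 : ℕ)) = -1 := by push_cast; ring
        have hcb : ((m + 1).centralBinom : ℝ) = 2 * (2 * m + 1).choose m := by
          have : (m + 1).centralBinom = 2 * (2 * m + 1).choose m := by
            rw [Nat.centralBinom, show 2 * (m + 1) = 2 * m + 1 + 1 by ring, Nat.choose_succ_succ,
              Nat.choose_symm_half]
            ring
          exact_mod_cast this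
        have e1 : walk q (walk q Real.sign) 1 = 1 - 2 * ((1 - q) / 2) ^ 2 := by
          norm_num [walk, Real.sign_of_pos, Real.sign_of_neg]
          ring
        have e2 : walk q (walk q Real.sign) (-1) = -1 + 2 * ((1 + q) / 2) ^ 2 := by
          norm_num [walk, Real.sign_of_pos, Real.sign_of_neg]
          ring
        rw [sum_pair (by simp)]
        simp only [h1, h2]
        rw [e1, e2, Real.sign_one, Real.sign_neg, Real.sign_one, Nat.choose_symm_half, hcb,
          show (1 - q ^ 2) ^ (m + 1) =
            4 ^ (m + 1) * (((1 + q) / 2) ^ (m + 1) * ((1 - q) / 2) ^ (m + 1)) by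
              rw [← mul_pow, ← mul_pow]; congr 1; ring]
        field_simp
        ring
      · intro ij hij
        simp only [mem_insert, mem_singleton] at hij
        rcases hij with rfl | rfl <;> simp <;> ring
      · rintro ⟨i, j⟩ hij hne
        simp only [mem_insert, mem_singleton, Prod.mk.injEq, not_or, not_and] at hne
        have hij' : i + j = 2 * m + 1 := mem_antidiagonal.1 hij
        rw [sub_eq_zero]
        congr 2
        simp only
        have hcast : (0 : ℝ) + ((i : ℝ) - j) = (((i : ℤ) - j : ℤ) : ℝ) := by push_cast; ring
        rw [hcast]
        apply walk_walk_sign_sub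
        · exact_mod_cast (by omega : ((i : ℤ) - j) ≠ 1)
        · exact_mod_cast (by omega : ((i : ℤ) - j) ≠ -1)
        · exact_mod_cast (by rw [le_abs]; omega : 1 ≤ |(i : ℤ) - j|)
        · intro _
          exact_mod_cast (by rw [lt_abs]; omega : 2 < |(i : ℤ) - j|)
    rw [show 2 * (m + 1) + 1 = 2 * m + 1 + 2 by ring, Function.iterate_add_apply,
      show (walk q)^[2] Real.sign = walk q (walk q Real.sign) from rfl, sum_range_succ, mul_add,
      ← ih, ← hdiff]
    ring

/-- The slope at `0` of the expected sign of a walk of `2 m + 1` steps with mean `q`. -/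
noncomputable def slope (m : ℕ) : ℝ := ∑ i ∈ range (m + 1), (i.centralBinom : ℝ) / 4 ^ i

theorem slope_nonneg (m : ℕ) : 0 ≤ slope m := sum_nonneg fun _ _ => by positivity

theorem slope_eq (m : ℕ) : slope m = (2 * m + 1) * ((m.centralBinom : ℝ) / 4 ^ m) := by
  induction m with
  | zero => simp [slope]
  | succ m ih =>
    have h : ((m : ℝ) + 1) * (m + 1).centralBinom = 2 * (2 * m + 1) * m.centralBinom := by
      exact_mod_cast Nat.succ_mul_centralBinom_succ m
    have hm : (m.centralBinom : ℝ) = (m + 1) * (m + 1).centralBinom / (2 * (2 * m + 1)) := by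
      rw [h]; field_simp
    rw [slope, sum_range_succ, ← slope, ih, hm]
    push_cast
    field_simp
    ring

theorem succ_le_slope_sq (m : ℕ) : (m : ℝ) + 1 ≤ slope m ^ 2 := by
  induction m with
  | zero => simp [slope]
  | succ m ih =>
    have h : ((m : ℝ) + 1) * (m + 1).centralBinom = 2 * (2 * m + 1) * m.centralBinom := by
      exact_mod_cast Nat.succ_mul_centralBinom_succ m
    have hrec : slope (m + 1) = (2 * m + 3) / (2 * m + 2) * slope m := by
      have hm : ((m + 1).centralBinom : ℝ) = 2 * (2 * m + 1) * m.centralBinom / (m + 1) := by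
        rw [← h]; field_simp
      rw [slope_eq, slope_eq, hm]
      push_cast
      field_simp
      ring
    rw [hrec, mul_pow]
    calc ((m + 1 : ℕ) : ℝ) + 1 ≤ ((2 * m + 3) / (2 * m + 2)) ^ 2 * (m + 1) := by
          push_cast
          rw [div_pow, div_mul_eq_mul_div, le_div_iff₀ (by positivity)]
          nlinarith
      _ ≤ _ := by gcongr

theorem abs_walk_sign_sub_le {q : ℝ} (hq : |q| ≤ 1) (m : ℕ) :
    |(walk q)^[2 * m + 1] Real.sign 0 - slope m * q| ≤ slope m * (m * |q| ^ 3) := by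
  have hq2 : q ^ 2 ≤ 1 := by
    rw [← sq_abs]; exact pow_le_one₀ (abs_nonneg q) hq
  have h : (walk q)^[2 * m + 1] Real.sign 0 - slope m * q =
      -(q * ∑ i ∈ range (m + 1), (i.centralBinom : ℝ) / 4 ^ i * (1 - (1 - q ^ 2) ^ i)) := by
    rw [walk_iterate_sign, slope]
    simp only [mul_sub, sum_sub_distrib, mul_one]
    ring
  have hterm : ∀ i ∈ range (m + 1), |(i.centralBinom : ℝ) / 4 ^ i * (1 - (1 - q ^ 2) ^ i)| ≤
      (i.centralBinom : ℝ) / 4 ^ i * (m * q ^ 2) := by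
    intro i hi
    have hb := one_add_mul_le_pow (show (-2 : ℝ) ≤ -q ^ 2 by linarith) i
    have h1 : (1 - q ^ 2) ^ i ≤ 1 := pow_le_one₀ (by linarith) (by linarith [sq_nonneg q])
    have him : (i : ℝ) ≤ m := by exact_mod_cast Nat.lt_succ_iff.1 (mem_range.1 hi)
    rw [← sub_eq_add_neg] at hb
    rw [abs_mul, abs_of_nonneg (by positivity : (0 : ℝ) ≤ (i.centralBinom : ℝ) / 4 ^ i),
      abs_of_nonneg (by linarith)]
    gcongr
    nlinarith [sq_nonneg q]
  rw [h, abs_neg, abs_mul]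
  calc |q| * |∑ i ∈ range (m + 1), (i.centralBinom : ℝ) / 4 ^ i * (1 - (1 - q ^ 2) ^ i)|
      ≤ |q| * ∑ i ∈ range (m + 1), (i.centralBinom : ℝ) / 4 ^ i * (m * q ^ 2) := by
        gcongr
        exact (abs_sum_le_sum_abs _ _).trans (sum_le_sum hterm)
    _ = slope m * (m * |q| ^ 3) := by
        rw [← sum_mul, ← slope, pow_succ |q| 2, sq_abs]; ring

theorem expect_abs_linear_cube_le (p : Fin n → ℝ) :
    (expect fun x => |∑ j, p j * rad (x j)| ^ 3) ≤ 5 * √(∑ j, p j ^ 2) ^ 3 := by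
  set s := √(∑ j, p j ^ 2) with hs
  have hS : 0 ≤ ∑ j, p j ^ 2 := sum_nonneg fun _ _ => sq_nonneg _
  have hs2 : s ^ 2 = ∑ j, p j ^ 2 := Real.sq_sqrt hS
  have hs0 : 0 ≤ s := Real.sqrt_nonneg _
  rcases hs0.eq_or_lt with h0 | hpos
  · have hz : ∀ j, p j = 0 := by
      rw [← h0, eq_comm, zero_pow two_ne_zero, sum_eq_zero_iff_of_nonneg fun _ _ => sq_nonneg _]
        at hs2
      exact fun j => by simpa using hs2 j (mem_univ j)
    rw [← h0]
    simp [hz, expect]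
  · have hpt : ∀ x : Cube n, 2 * s * |∑ j, p j * rad (x j)| ^ 3 ≤
        s ^ 2 * (∑ j, p j * rad (x j)) ^ 2 + (∑ j, p j * rad (x j)) ^ 4 := by
      intro x
      set L := ∑ j, p j * rad (x j)
      have h2 : L ^ 2 = |L| ^ 2 := (sq_abs L).symm
      have h4 : L ^ 4 = |L| ^ 4 := by rw [show L ^ 4 = (L ^ 2) ^ 2 by ring, h2]; ring
      rw [h2, h4]
      nlinarith [sq_nonneg (|L| * (s - |L|))]
    have h := expect_mono hpt
    rw [expect_const_mul, expect_add, expect_const_mul, expect_linear_sq, ← hs2] at h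
    have h4 := expect_linear_pow_four_le p
    rw [← hs2] at h4
    refine le_of_mul_le_mul_left ?_ (by positivity : 0 < 2 * s)
    nlinarith

/-- If all majorities with natural weights have correlation at most `c` with `f`, and the first
level coefficients of `f` are nonnegative, then the first level is small. The test function is the
expected sign of a walk along coordinates chosen with probabilities proportional to
`coeff f {j}`; its number of steps is about `√W / s ^ 2`, where `s ^ 2` is the variance of its
mean, so that its linear part dominates. -/
theorem sqrt_levelOne_cube_le {f : Cube n → ℝ} (hf : ∀ x, |f x| ≤ 1)
    (ha : ∀ j, 0 ≤ coeff f {j}) {c : ℝ}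
    (hc : ∀ w : Fin n → ℕ, |expect fun x => f x * Real.sign (∑ j, (w j : ℝ) * rad (x j))| ≤ c) :
    √(levelOne f) ^ 3 ≤ 40 * c ^ 2 := by
  have hc0 : 0 ≤ c := (abs_nonneg _).trans (hc 0)
  set r := √(levelOne f) with hr
  have hr0 : 0 ≤ r := Real.sqrt_nonneg _
  rcases hr0.eq_or_lt with h0 | hrpos
  · rw [← h0, zero_pow three_ne_zero]; positivity
  have hr2 : r ^ 2 = levelOne f := Real.sq_sqrt (levelOne_nonneg f)
  set a : Fin n → ℝ := fun j => coeff f {j} with hadef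
  have hApos : 0 < ∑ j, a j := by
    refine (sum_nonneg fun j _ => ha j).lt_of_ne fun h => ?_
    have hz := (sum_eq_zero_iff_of_nonneg fun j _ => ha j).1 h.symm
    have : levelOne f = 0 := sum_eq_zero fun j hj => by rw [hz j hj]; norm_num
    rw [this] at hr2
    exact hrpos.ne' (pow_eq_zero_iff two_ne_zero |>.1 hr2)
  set Z := ∑ j, a j with hZ
  set p : Fin n → ℝ := fun j => a j / Z with hpdef
  have hp0 : ∀ j, 0 ≤ p j := fun j => div_nonneg (ha j) hApos.le
  have hp1 : ∑ j, p j = 1 := by rw [hpdef, ← sum_div, div_self hApos.ne']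
  set s := r / Z with hsdef
  have hspos : 0 < s := div_pos hrpos hApos
  have hs : √(∑ j, p j ^ 2) = s := by
    have : ∑ j, p j ^ 2 = s ^ 2 := by
      simp only [hpdef, hsdef, div_pow, hr2, ← sum_div, levelOne, hadef]
    rw [this, Real.sqrt_sq hspos.le]
  set L : Cube n → ℝ := fun x => ∑ j, p j * rad (x j) with hL
  have hL1 : ∀ x, |L x| ≤ 1 := by
    intro x
    rw [← hp1]
    refine (abs_sum_le_sum_abs _ _).trans (sum_le_sum fun j _ => ?_)
    rw [abs_mul, abs_of_nonneg (hp0 j)]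
    cases x j <;> simp
  have hfL : (expect fun x => f x * L x) = s * r := by
    have : (expect fun x => f x * L x) = ∑ j, p j * a j := by
      simp only [hadef, coeff, ← expect_const_mul]
      rw [← expect_sum]
      congr 1
      funext x
      rw [hL, mul_sum]
      exact sum_congr rfl fun j _ => by rw [walsh_singleton]; ring
    have h2 : ∑ j, p j * a j = (∑ j, a j ^ 2) / Z := by
      rw [sum_div]
      exact sum_congr rfl fun j _ => by rw [hpdef]; ring
    rw [this, h2, show ∑ j, a j ^ 2 = r ^ 2 from hr2.symm, hsdef]
    ring
  set m := ⌊r / (10 * s ^ 2)⌋₊ with hm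
  have hm1 : 10 * s ^ 2 * m ≤ r := by
    have := Nat.floor_le (by positivity : 0 ≤ r / (10 * s ^ 2))
    rw [le_div_iff₀ (by positivity)] at this
    linarith
  have hm2 : r ≤ 10 * s ^ 2 * (m + 1) := by
    have := (Nat.lt_floor_add_one (r / (10 * s ^ 2))).le
    rw [div_le_iff₀ (by positivity)] at this
    linarith
  clear_value m s
  have hcorr : |expect fun x => f x * (walk (L x))^[2 * m + 1] Real.sign 0| ≤ c := by
    simpa using abs_expect_walk_le hc hp0 hp1 (2 * m + 1) 0
  have hlow : slope m * (s * r) - slope m * (m * (5 * s ^ 3)) ≤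
      expect fun x => f x * (walk (L x))^[2 * m + 1] Real.sign 0 := by
    have h3 := expect_abs_linear_cube_le p
    rw [hs] at h3
    calc slope m * (s * r) - slope m * (m * (5 * s ^ 3))
        ≤ slope m * (s * r) - slope m * (m * expect fun x => |L x| ^ 3) := by
          have := slope_nonneg m
          gcongr
      _ = expect fun x => slope m * (f x * L x) - slope m * (m * |L x| ^ 3) := by
          rw [expect_sub, expect_const_mul, expect_const_mul, expect_const_mul, hfL]
      _ ≤ _ := by
          refine expect_mono fun x => ?_
          have h1 := abs_walk_sign_sub_le (hL1 x) m
          have h2 : |f x * ((walk (L x))^[2 * m + 1] Real.sign 0 - slope m * L x)| ≤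
              1 * (slope m * (m * |L x| ^ 3)) := by
            rw [abs_mul]
            exact mul_le_mul (hf x) h1 (abs_nonneg _) zero_le_one
          have := (abs_le.1 h2).1
          linarith
  have hmain : slope m * (s * r) / 2 ≤ c := by
    have h1 := hlow.trans ((le_abs_self _).trans hcorr)
    have h2 : m * (5 * s ^ 3) ≤ s * r / 2 := by nlinarith
    have := mul_le_mul_of_nonneg_left h2 (slope_nonneg m)
    linarith
  have hnn : 0 ≤ slope m * (s * r) / 2 :=
    div_nonneg (mul_nonneg (slope_nonneg m) (mul_nonneg hspos.le hr0)) zero_le_two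
  have hsq : (slope m * (s * r) / 2) ^ 2 ≤ c ^ 2 := pow_le_pow_left₀ hnn hmain 2
  have hslope := succ_le_slope_sq m
  have h5 : r ≤ 10 * s ^ 2 * slope m ^ 2 := hm2.trans (by gcongr)
  calc r ^ 3 = r * r ^ 2 := by ring
    _ ≤ 10 * s ^ 2 * slope m ^ 2 * r ^ 2 := by gcongr
    _ = 40 * (slope m * (s * r) / 2) ^ 2 := by ring
    _ ≤ 40 * c ^ 2 := by gcongr

/-! ### Noise stability of weighted majorities -/

theorem abs_sign_sub_sign (S V : ℝ) :
    |Real.sign S - Real.sign (S - 2 * V)| =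
      Real.sign V * (Real.sign S - Real.sign (S - 2 * V)) := by
  have hmono : ∀ {s t : ℝ}, s ≤ t → Real.sign s ≤ Real.sign t := by
    intro s t h
    rcases lt_trichotomy s 0 with hs | hs | hs
    · rw [Real.sign_of_neg hs]
      exact (abs_le.1 (abs_sign_le_one t)).1
    · rw [hs, Real.sign_zero]
      rcases (hs ▸ h).eq_or_lt with ht | ht
      · rw [← ht, Real.sign_zero]
      · rw [Real.sign_of_pos ht]; exact zero_le_one
    · rw [Real.sign_of_pos hs, Real.sign_of_pos (hs.trans_le h)]
  rcases lt_trichotomy V 0 with hV | hV | hV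
  · have := hmono (by linarith : S ≤ S - 2 * V)
    rw [Real.sign_of_neg hV, abs_of_nonpos (by linarith)]
    ring
  · simp [hV]
  · have := hmono (by linarith : S - 2 * V ≤ S)
    rw [Real.sign_of_pos hV, abs_of_nonneg (by linarith)]
    ring

variable {m : ℕ}

/-- The block of coordinates with label `i`. -/
def block (b : Fin n → Fin m) (i : Fin m) : Finset (Fin n) := univ.filter fun j => b j = i

theorem sum_block_flip (b : Fin n → Fin m) (w : Fin n → ℝ) (i k : Fin m) (x : Cube n) :
    ∑ j ∈ block b k, w j * rad (flip (block b i) x j) =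
      (if k = i then -1 else 1) * ∑ j ∈ block b k, w j * rad (x j) := by
  rw [mul_sum]
  refine sum_congr rfl fun j hj => ?_
  have hj' : b j = k := (mem_filter.1 hj).2
  by_cases h : k = i
  · simp [flip, block, hj', h]
  · simp [flip, block, hj', h]

theorem sum_sum_block (b : Fin n → Fin m) (F : Fin n → ℝ) :
    ∑ i, ∑ j ∈ block b i, F j = ∑ j, F j :=
  sum_fiberwise univ b F

/-- The total influence of the `m` blocks on a weighted majority is at most `2 √m`: flipping a
block can only move the majority against the sign of the block, and the signs of the blocks are
uncorrelated. -/
theorem sum_expect_abs_sub_flip_le (b : Fin n → Fin m) (w : Fin n → ℝ) :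
    ∑ i, (expect fun x => |weightedMajority w x - weightedMajority w (flip (block b i) x)|) ≤
      2 * √m := by
  set V : Fin m → Cube n → ℝ := fun i x => ∑ j ∈ block b i, w j * rad (x j) with hV
  set s : Fin m → Cube n → ℝ := fun i x => Real.sign (V i x) with hs
  set M : Cube n → ℝ := weightedMajority w with hM
  have hVflip : ∀ i k x, V k (flip (block b i) x) = (if k = i then -1 else 1) * V k x :=
    fun i k x => sum_block_flip b w i k x
  have hsflip : ∀ i k x, s k (flip (block b i) x) = (if k = i then -1 else 1) * s k x := by
    intro i k x
    simp only [hs, hVflip]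
    split_ifs
    · rw [neg_one_mul, Real.sign_neg, neg_one_mul]
    · rw [one_mul, one_mul]
  have hMV : ∀ x, M x = Real.sign (∑ i, V i x) := by
    intro x
    rw [hM, weightedMajority_eq, hV]
    simp only
    rw [sum_sum_block b fun j => w j * rad (x j)]
  have hMflip : ∀ i x, M (flip (block b i) x) = Real.sign (∑ k, V k x - 2 * V i x) := by
    intro i x
    rw [hMV]
    congr 1
    have : ∀ k, V k (flip (block b i) x) = V k x - if k = i then 2 * V i x else 0 := by
      intro k
      rw [hVflip]
      split_ifs with h
      · rw [h]; ring
      · ring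
    simp only [this]
    simp
  have hinfl : ∀ i, (expect fun x => |M x - M (flip (block b i) x)|) =
      2 * expect fun x => M x * s i x := by
    intro i
    have h1 : (expect fun x => |M x - M (flip (block b i) x)|) =
        expect fun x => M x * s i x + M (flip (block b i) x) * s i (flip (block b i) x) := by
      congr 1
      funext x
      rw [hsflip, if_pos rfl, hMflip, hMV, abs_sign_sub_sign]
      ring
    rw [h1, expect_add, expect_flip (block b i) fun x => M x * s i x]
    ring
  have hcross : ∀ i k, i ≠ k → (expect fun x => s i x * s k x) = 0 := by
    intro i k hik
    refine expect_eq_zero_of_flip (block b i) fun x => ?_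
    rw [hsflip, hsflip, if_pos rfl, if_neg hik.symm]
    ring
  have hs1 : ∀ i x, s i x ^ 2 ≤ 1 := fun i x => by
    rw [← sq_abs]
    exact pow_le_one₀ (abs_nonneg _) (abs_sign_le_one _)
  have hsum2 : (expect fun x => (∑ i, s i x) ^ 2) ≤ m := by
    simp only [sq, sum_mul_sum]
    rw [expect_sum]
    have : ∀ i, (expect fun x => ∑ k, s i x * s k x) ≤ 1 := by
      intro i
      rw [expect_sum, sum_eq_single i]
      · rw [← expect_const (n := n) 1]
        refine expect_mono fun x => ?_
        rw [← sq]
        exact hs1 i x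
      · exact fun k _ hk => hcross i k hk.symm
      · simp
    refine (sum_le_sum fun i _ => this i).trans ?_
    simp
  have hM2 : (expect fun x => M x ^ 2) ≤ 1 := by
    rw [← expect_const (n := n) 1]
    refine expect_mono fun x => ?_
    rw [← sq_abs, hMV]
    exact pow_le_one₀ (abs_nonneg _) (abs_sign_le_one _)
  have hCS := expect_mul_sq_le M fun x => ∑ i, s i x
  have hfin : (expect fun x => M x * ∑ i, s i x) ≤ √m := by
    refine Real.le_sqrt_of_sq_le (hCS.trans ?_)
    have h0 : 0 ≤ expect fun x => (∑ i, s i x) ^ 2 := expect_nonneg fun x => sq_nonneg _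
    exact (mul_le_of_le_one_left h0 hM2).trans hsum2
  simp only [hinfl, ← mul_sum]
  rw [← expect_sum]
  simp only [← mul_sum]
  linarith

/-- Flipping the block with a given label, for a uniformly random labelling of the coordinates
with `m` labels, is the noise with flip probability `1 / m`. -/
theorem sum_flip_block (hm : 0 < m) (i : Fin m) (x : Cube n) (F : Cube n → ℝ) :
    ∑ b : Fin n → Fin m, F (flip (block b i) x) =
      m ^ n * ∑ y, noiseWeight (1 / m) x y * F y := by
  have hm' : (m : ℝ) ≠ 0 := by positivity
  have h1 : ∀ (b : Fin n → Fin m) (y : Cube n), (if flip (block b i) x = y then (1 : ℝ) else 0) =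
      ∏ j, if (if b j = i then !x j else x j) = y j then 1 else 0 := by
    intro b y
    rw [prod_boole]
    simp [funext_iff, flip, block]
  have h2 : ∀ y : Cube n, (∑ b : Fin n → Fin m,
      ∏ j, if (if b j = i then !x j else x j) = y j then (1 : ℝ) else 0) =
      m ^ n * noiseWeight (1 / m) x y := by
    intro y
    have := prod_univ_sum (fun _ : Fin n => (univ : Finset (Fin m)))
      fun j k => if (if k = i then !x j else x j) = y j then (1 : ℝ) else 0
    rw [Fintype.piFinset_univ] at this
    rw [← this, noiseWeight, show (m : ℝ) ^ n = ∏ _j : Fin n, (m : ℝ) by simp, ← prod_mul_distrib]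
    refine prod_congr rfl fun j _ => ?_
    have hsplit : ∀ k : Fin m, (if (if k = i then !x j else x j) = y j then (1 : ℝ) else 0) =
        (if x j = y j then 1 else 0) +
          if k = i then (if x j = y j then -1 else 1) else 0 := by
      intro k
      by_cases hk : k = i <;> cases x j <;> cases y j <;> simp [hk]
    simp only [hsplit]
    rw [sum_add_distrib]
    by_cases hxy : x j = y j
    · simp [hxy]
      field_simp
      ring
    · simp [hxy, Ne.symm hxy, hm']
  calc ∑ b : Fin n → Fin m, F (flip (block b i) x)
      = ∑ b : Fin n → Fin m, ∑ y, (if flip (block b i) x = y then (1 : ℝ) else 0) * F y := by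
        simp
    _ = ∑ y, (∑ b : Fin n → Fin m, if flip (block b i) x = y then (1 : ℝ) else 0) * F y := by
        rw [sum_comm]; simp only [sum_mul]
    _ = _ := by
        simp only [h1, h2, mul_sum, mul_assoc]

/-- Weighted majorities are uniformly stable under noise, with a bound that depends neither on
the weights nor on the dimension (Peres). -/
theorem expect_sum_noiseWeight_abs_sub_le (hm : 0 < m) (w : Fin n → ℝ) :
    (expect fun x => ∑ y, noiseWeight (1 / m) x y * |weightedMajority w x - weightedMajority w y|) ≤
      2 / √m := by
  have hm' : (0 : ℝ) < m := by exact_mod_cast hm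
  set M : Cube n → ℝ := weightedMajority w with hM
  set Q := expect fun x => ∑ y, noiseWeight (1 / m) x y * |M x - M y| with hQ
  have h1 : ∀ i : Fin m, ∑ b : Fin n → Fin m, (expect fun x => |M x - M (flip (block b i) x)|) =
      m ^ n * Q := by
    intro i
    rw [← expect_sum, hQ, ← expect_const_mul]
    congr 1
    funext x
    exact sum_flip_block hm i x fun y => |M x - M y|
  have h2 : ∑ b : Fin n → Fin m, ∑ i, (expect fun x => |M x - M (flip (block b i) x)|) ≤
      ∑ _b : Fin n → Fin m, 2 * √m := sum_le_sum fun b _ => sum_expect_abs_sub_flip_le b w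
  rw [sum_comm] at h2
  simp only [h1] at h2
  simp only [sum_const, card_univ, Fintype.card_fin, Fintype.card_pi, prod_const, nsmul_eq_mul,
    Nat.cast_pow] at h2
  rw [le_div_iff₀ (Real.sqrt_pos.2 hm')]
  have h3 : m * Q ≤ 2 * √m := by
    refine le_of_mul_le_mul_left ?_ (by positivity : (0 : ℝ) < m ^ n)
    linarith
  refine le_of_mul_le_mul_right ?_ (Real.sqrt_pos.2 hm')
  calc Q * √m * √m = m * Q := by rw [mul_assoc, Real.mul_self_sqrt hm'.le, mul_comm]
    _ ≤ 2 * √m := h3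

theorem expect_weightedMajority (w : Fin n → ℝ) : expect (weightedMajority w) = 0 := by
  refine expect_eq_zero_of_flip univ fun x => ?_
  simp only [weightedMajority_eq]
  rw [← Real.sign_neg]
  simp [flip]

/-! ### Sensitivity gauge and majority correlations -/

theorem chi_nonneg (A : Set (Cube n)) (x : Cube n) : 0 ≤ chi A x :=
  Set.indicator_nonneg (fun _ _ => zero_le_one) x

theorem chi_le_one (A : Set (Cube n)) (x : Cube n) : chi A x ≤ 1 :=
  Set.indicator_le_self' (fun _ _ => zero_le_one) x

theorem chi_of_mem {A : Set (Cube n)} {x : Cube n} (h : x ∈ A) : chi A x = 1 :=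
  Set.indicator_of_mem h 1

theorem chi_of_notMem {A : Set (Cube n)} {x : Cube n} (h : x ∉ A) : chi A x = 0 :=
  Set.indicator_of_notMem h 1

theorem prob_nonneg (A : Set (Cube n)) : 0 ≤ prob A := expect_nonneg (chi_nonneg A)

theorem prob_le_one (A : Set (Cube n)) : prob A ≤ 1 := by
  rw [← expect_const (n := n) 1]
  exact expect_mono (chi_le_one A)

theorem noiseWeight_nonneg {ε : ℝ} (h0 : 0 ≤ ε) (h1 : ε ≤ 1) (x y : Cube n) :
    0 ≤ noiseWeight ε x y :=
  prod_nonneg fun j _ => by split_ifs <;> linarith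

theorem abs_noiseProb_sub_prob_le_one (A : Set (Cube n)) {ε : ℝ} (h0 : 0 ≤ ε) (h1 : ε ≤ 1)
    (x : Cube n) : |noiseProb A ε x - prob A| ≤ 1 := by
  have ha : 0 ≤ noiseProb A ε x :=
    sum_nonneg fun y _ => mul_nonneg (noiseWeight_nonneg h0 h1 x y) (chi_nonneg A y)
  have hb : noiseProb A ε x ≤ 1 := by
    rw [← sum_noiseWeight ε x]
    exact sum_le_sum fun y _ =>
      mul_le_of_le_one_right (noiseWeight_nonneg h0 h1 x y) (chi_le_one A y)
  have := prob_nonneg A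
  have := prob_le_one A
  exact abs_le.2 ⟨by linarith, by linarith⟩

theorem gauge_nonneg (A : Set (Cube n)) (ε : ℝ) : 0 ≤ gauge A ε :=
  Real.sInf_nonneg fun _ h => h.1.le

/-- Chebyshev's inequality bounds the gauge by the variance of `P(N_ε(x) ∈ A | x)`. -/
theorem gauge_le_of_expect_sq_lt (A : Set (Cube n)) {ε δ : ℝ} (hδ : 0 < δ)
    (h : (expect fun x => (noiseProb A ε x - prob A) ^ 2) < δ ^ 3) : gauge A ε ≤ δ := by
  refine csInf_le ⟨0, fun _ h => h.1.le⟩ ⟨hδ, ?_⟩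
  have hle : δ ^ 2 * gamma A ε δ ≤ expect fun x => (noiseProb A ε x - prob A) ^ 2 := by
    rw [gamma, prob, ← expect_const_mul]
    refine expect_mono fun x => ?_
    by_cases hx : x ∈ {x : Cube n | |noiseProb A ε x - prob A| > δ}
    · rw [chi_of_mem hx, mul_one, ← sq_abs (noiseProb A ε x - prob A)]
      exact pow_le_pow_left₀ hδ.le (le_of_lt hx) 2
    · rw [chi_of_notMem hx, mul_zero]
      exact sq_nonneg _
  refine lt_of_mul_lt_mul_left (hle.trans_lt (h.trans_eq ?_)) (sq_nonneg δ)
  ring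

/-- The gauge bounds the first absolute moment of `P(N_ε(x) ∈ A | x) - P(A)`. -/
theorem expect_abs_le_of_gauge_lt (A : Set (Cube n)) {ε δ : ℝ} (h0 : 0 ≤ ε) (h1 : ε ≤ 1)
    (h : gauge A ε < δ) : (expect fun x => |noiseProb A ε x - prob A|) ≤ 2 * δ := by
  obtain ⟨δ', ⟨hδ0, hδ'⟩, hlt⟩ := exists_lt_of_csInf_lt
    (⟨2, two_pos, (prob_le_one _).trans_lt one_lt_two⟩ :
      {δ : ℝ | 0 < δ ∧ gamma A ε δ < δ}.Nonempty) h
  have hle : (expect fun x => |noiseProb A ε x - prob A|) ≤ δ' + gamma A ε δ' := by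
    rw [gamma, prob.eq_1 {x : Cube n | _}, ← expect_const (n := n) δ', ← expect_add]
    simp only [expect_const]
    refine expect_mono fun x => ?_
    by_cases hx : x ∈ {x : Cube n | |noiseProb A ε x - prob A| > δ'}
    · rw [chi_of_mem hx]
      have := abs_noiseProb_sub_prob_le_one A h0 h1 x
      linarith
    · rw [chi_of_notMem hx, add_zero]
      exact not_lt.1 hx
  linarith

theorem maxMajorityCorrelation_nonneg (A : Set (Cube n)) : 0 ≤ maxMajorityCorrelation A := by
  obtain ⟨w, -, h⟩ := (isGreatest_maxMajorityCorrelation A).1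
  rw [h]
  exact abs_nonneg _

theorem abs_expect_sign_le_maxMajorityCorrelation (A : Set (Cube n)) (w : Fin n → ℕ) :
    |expect fun x => chi A x * Real.sign (∑ j, (w j : ℝ) * rad (x j))| ≤
      maxMajorityCorrelation A := by
  -- Dividing the weights by `c` brings them into `[0, 1]`; the `1` keeps `c` positive.
  set c : ℝ := ∑ j, (w j : ℝ) + 1 with hc
  have hsum : 0 ≤ ∑ j, (w j : ℝ) := sum_nonneg fun j _ => Nat.cast_nonneg _
  have hcpos : 0 < c := by linarith
  refine (isGreatest_maxMajorityCorrelation A).2 ⟨fun j => w j / c, fun j => ⟨by positivity, ?_⟩, ?_⟩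
  · rw [div_le_one hcpos]
    have : (w j : ℝ) ≤ ∑ j, (w j : ℝ) :=
      single_le_sum (f := fun j => (w j : ℝ)) (fun j _ => Nat.cast_nonneg _) (mem_univ j)
    linarith
  · have hsign : ∀ t : ℝ, Real.sign (t / c) = Real.sign t := by
      intro t
      rcases lt_trichotomy t 0 with h | h | h
      · rw [Real.sign_of_neg h, Real.sign_of_neg (div_neg_of_neg_of_pos h hcpos)]
      · rw [h, zero_div]
      · rw [Real.sign_of_pos h, Real.sign_of_pos (div_pos h hcpos)]
    simp only [weightedMajority_eq, div_mul_eq_mul_div, ← sum_div, hsign]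

theorem coeff_singleton_nonneg {f : Cube n → ℝ} (hf : Monotone f) (j : Fin n) :
    0 ≤ coeff f {j} := by
  have h : coeff f {j} = expect (noiseOp (outside univ) fun y => f y * rad (y j)) := by
    rw [← coeff_empty, coeff_noiseOp, coeff_mul_rad, ← bot_eq_empty, bot_symmDiff]
    simp
  rw [h]
  exact expect_nonneg fun x => noiseOp_outside_mul_rad_nonneg hf (mem_univ j) x

theorem expect_chi_sq_le_one (A : Set (Cube n)) : (expect fun x => chi A x ^ 2) ≤ 1 := by
  rw [← expect_const (n := n) 1]
  exact expect_mono fun x => pow_le_one₀ (chi_nonneg A x) (chi_le_one A x)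

/-- Weighted majorities are almost fixed by the noise with flip probability `1 / m`, so their
correlation with `A` is nearly their correlation with `P(N_ε(x) ∈ A | x)`. -/
theorem abs_expect_chi_mul_weightedMajority_le (A : Set (Cube n)) (w : Fin n → ℝ) {m : ℕ}
    (hm : 0 < m) :
    |expect fun x => chi A x * weightedMajority w x| ≤
      2 / √m + expect fun x => |noiseProb A (1 / m) x - prob A| := by
  set M : Cube n → ℝ := weightedMajority w with hM
  set ε : ℝ := 1 / m with hε
  have hm1 : (1 : ℝ) ≤ m := by exact_mod_cast hm
  have h0 : 0 ≤ ε := by positivity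
  have h1 : ε ≤ 1 := by rw [hε]; exact div_le_one_of_le₀ hm1 (by positivity)
  set T : Cube n → ℝ := noiseOp (fun _ => 1 - 2 * ε) M with hT
  have hM1 : ∀ x, |M x| ≤ 1 := fun x => by
    rw [hM, weightedMajority_eq]; exact abs_sign_le_one _
  have hsplit : (expect fun x => chi A x * M x) = (expect fun x => chi A x * (M x - T x)) +
      expect fun x => (noiseProb A ε x - prob A) * M x := by
    have e1 : (expect fun x => chi A x * T x) = expect fun x => noiseProb A ε x * M x := by
      simp only [noiseProb_eq]
      exact (expect_noiseOp_mul _ _ _).symm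
    simp only [mul_sub, sub_mul]
    rw [expect_sub, expect_sub, expect_const_mul, expect_weightedMajority, e1]
    ring
  have hstable : |expect fun x => chi A x * (M x - T x)| ≤ 2 / √m := by
    refine (abs_expect_le _).trans (le_trans (expect_mono fun x => ?_)
      (expect_sum_noiseWeight_abs_sub_le hm w))
    have e2 : M x - T x = ∑ y, noiseWeight ε x y * (M x - M y) := by
      simp only [mul_sub, sum_sub_distrib, ← sum_mul, sum_noiseWeight, one_mul, hT,
        ← sum_noiseWeight_mul]
    rw [abs_mul, abs_of_nonneg (chi_nonneg A x)]
    refine (mul_le_of_le_one_left (abs_nonneg _) (chi_le_one A x)).trans ?_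
    rw [e2]
    refine (abs_sum_le_sum_abs _ _).trans (sum_le_sum fun y _ => ?_)
    rw [abs_mul, abs_of_nonneg (noiseWeight_nonneg h0 h1 x y)]
  have hsens : |expect fun x => (noiseProb A ε x - prob A) * M x| ≤
      expect fun x => |noiseProb A ε x - prob A| := by
    refine (abs_expect_le _).trans (expect_mono fun x => ?_)
    rw [abs_mul]
    exact mul_le_of_le_one_right (abs_nonneg _) (hM1 x)
  rw [hsplit]
  exact (abs_add_le _ _).trans (add_le_add hstable hsens)

theorem tendsto_maxMajorityCorrelation {n : ℕ → ℕ} {A : ∀ m, Set (Cube (n m))}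
    (h : AsymptoticallyNoiseSensitive A) :
    Tendsto (fun m => maxMajorityCorrelation (A m)) atTop (𝓝 0) := by
  rw [Metric.tendsto_atTop']
  intro η hη
  have hlim : Tendsto (fun m : ℕ => 2 / √(m : ℝ)) atTop (𝓝 0) :=
    (Real.tendsto_sqrt_atTop.comp tendsto_natCast_atTop_atTop).const_div_atTop 2
  obtain ⟨m, hmη, hm⟩ := ((hlim.eventually_lt_const (half_pos hη)).and
    (eventually_ge_atTop 3)).exists
  have hm3 : (3 : ℝ) ≤ m := by exact_mod_cast hm
  have hε0 : (0 : ℝ) < 1 / m := by positivity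
  have hε : (1 : ℝ) / m < 1 / 2 := one_div_lt_one_div_of_lt two_pos (by linarith)
  obtain ⟨N, hN⟩ := eventually_atTop.1
    ((h _ hε0 hε).eventually_lt_const (by positivity : 0 < η / 8))
  refine ⟨N, fun k hk => ?_⟩
  rw [Real.dist_0_eq_abs, abs_of_nonneg (maxMajorityCorrelation_nonneg _)]
  obtain ⟨w, -, hw⟩ := (isGreatest_maxMajorityCorrelation (A k)).1
  have h1 := abs_expect_chi_mul_weightedMajority_le (A k) w (by omega : 0 < m)
  have h2 := expect_abs_le_of_gauge_lt (A k) hε0.le (by linarith) (hN k hk.le)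
  linarith

theorem asymptoticallyNoiseSensitive_of_tendsto {n : ℕ → ℕ} {A : ∀ m, Set (Cube (n m))}
    (hA : ∀ m, MonotoneEvent (A m))
    (h : Tendsto (fun m => maxMajorityCorrelation (A m)) atTop (𝓝 0)) :
    AsymptoticallyNoiseSensitive A := by
  intro ε hε0 hε
  rw [Metric.tendsto_atTop']
  intro η hη
  set δ := η / 2 with hδdef
  have hδ : 0 < δ := half_pos hη
  obtain ⟨D, hD⟩ := exists_pow_lt_of_lt_one (by positivity : 0 < δ ^ 3 / 2)
    (by linarith : 1 - 2 * ε < 1)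
  set κ : ℝ := δ ^ 3 / 2 / 6 ^ D with hκ
  have hκ0 : 0 < κ := by positivity
  have hsq : Tendsto (fun m => 40 * maxMajorityCorrelation (A m) ^ 2) atTop (𝓝 0) := by
    simpa using (h.pow 2).const_mul 40
  obtain ⟨N, hN⟩ := eventually_atTop.1 (hsq.eventually_lt_const (pow_pos hκ0 3))
  refine ⟨N, fun k hk => ?_⟩
  rw [Real.dist_0_eq_abs, abs_of_nonneg (gauge_nonneg _ _)]
  have hW : √(levelOne (chi (A k))) < κ := by
    refine lt_of_pow_lt_pow_left₀ 3 hκ0.le ((sqrt_levelOne_cube_le (fun x => ?_)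
      (coeff_singleton_nonneg (hA k)) (abs_expect_sign_le_maxMajorityCorrelation (A k))).trans_lt
        (hN k hk.le))
    rw [abs_of_nonneg (chi_nonneg _ x)]
    exact chi_le_one _ x
  have hvar := expect_noiseOp_sub_sq_le (hA k) (expect_chi_sq_le_one (A k))
    (by linarith : 0 ≤ 1 - 2 * ε) (by linarith) D
  have hlast : (6 : ℝ) ^ D * √(levelOne (chi (A k))) < δ ^ 3 / 2 := by
    rw [hκ, lt_div_iff₀ (by positivity)] at hW
    linarith
  refine (gauge_le_of_expect_sq_lt (A k) hδ ?_).trans_lt (half_lt_self hη)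
  simp only [noiseProb_eq]
  change (expect fun x => (_ - expect (chi (A k))) ^ 2) < _
  linarith

end NoiseSensitivity


theorem theorem1p5 (n : ℕ → ℕ) (A : ∀ m, Set (NoiseSensitivity.Cube (n m)))
    (hA : ∀ m, NoiseSensitivity.MonotoneEvent (A m)) :
    NoiseSensitivity.AsymptoticallyNoiseSensitive A ↔
      Tendsto (fun m => NoiseSensitivity.maxMajorityCorrelation (A m)) atTop (𝓝 0) :=
  ⟨NoiseSensitivity.tendsto_maxMajorityCorrelation,
    NoiseSensitivity.asymptoticallyNoiseSensitive_of_tendsto hA⟩
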